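/- **Proposition 2 (Mean Intensity).** Let $\phi^{?,s},\phi^{?,c}$, $?\in\{T,F,I,N\}$, be eight nonnegative integrable functions on $\mathbb R$ that vanish on $(-\infty,0)$, let $$\Phi^?_t=\begin{pmatrix}\phi^{?,s}_t&\phi^{?,c}_t\\ \phi^{?,c}_t&\phi^{?,s}_t\end{pmatrix},\qquad \Phi_t=\begin{pmatrix}\Phi^T_t&\Phi^F_t\\ \Phi^I_t&\Phi^N_t\end{pmatrix},\qquad M=(\mu,\mu,0,0)^{\top},\quad \mu\ge 0,$$ and write $\hat F_z=\int_{\mathbb R}e^{-izt}F_t\,dt$ entrywise. Let $P=(T^-,T^+,N^-,N^+)$ be a Hawkes process on $\mathbb R$ with exogenous intensity $M$ and kernel $\Phi$, that is, a four-dimensional counting process (unit jumps, no simultaneous jumps) whose conditional intensity with respect to its own history is $$\lambda_t=M+\int_{\mathbb R}\Phi_{t-s}\,dP_s .$$ Suppose that $P$ has stationary increments and that its mean intensity $E(\lambda_0)$ is finite. Assume (H): all (complex) eigenvalues of the matrix $\hat\Phi_0$ have modulus strictly smaller than $1$. Then $I-\hat\Phi_0$ is invertible, $\Lambda=E(\lambda_t)$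 is finite, does not depend on $t\in\mathbb R$ and has the form $\Lambda=(\Lambda^T,\Lambda^T,\Lambda^N,\Lambda^N)^{\top}$, and $$\Lambda=(I-\hat\Phi_0)^{-1}M .$$ Explicitly, with $v=(1,1)^{\top}$, $$\begin{pmatrix}\Lambda^T\\ \Lambda^T\end{pmatrix}=\mu(I+\hat D_0)(I-\hat\Phi^N_0)v,\qquad \begin{pmatrix}\Lambda^N\\ \Lambda^N\end{pmatrix}=\mu(I+\hat D_0)\hat\Phi^I_0v,$$ where $$\hat D_z=\big((I-\hat\Phi^T_z)(I-\hat\Phi^N_z)-\hat\Phi^F_z\hat\Phi^I_z\big)^{-1}-I,$$ the inverse existing for all $z\in\mathbb C$ with $\operatorname{Im}z\le 0$. -/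

import Mathlib

open MeasureTheory ProbabilityTheory
open scoped ENNReal NNReal Matrix

noncomputable section

namespace HawkesPrice

/-! ### Point processes on the real line and their conditional intensity

A counting process `(P_t)` indexed by the real line is represented by its random jump measure `dP`,
so that `P_b - P_a = dP (a, b]`. -/

section PointProcess

variable {Ω : Type*} [MeasurableSpace Ω] {ι : Type*}

/-- A multivariate counting process: random measures on the line that give a finite integer mass to
every bounded interval, have jumps of size one only, and never jump simultaneously. -/
structure IsCountingProcess [Fintype ι] (dP : ι → Ω → Measure ℝ) : Prop where
  measurable : ∀ i, Measurable (dP i)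
  integer : ∀ i ω a b, ∃ n : ℕ, dP i ω (Set.Ioc a b) = n
  simple : ∀ ω t, ∑ i, dP i ω {t} ≤ 1

/-- The internal history at time `t`: generated by all increments `P_b - P_a`, `b ≤ t`,
of all components. -/
@[reducible]
def history (dP : ι → Ω → Measure ℝ) (t : ℝ) : MeasurableSpace Ω :=
  ⨆ (i : ι) (a : ℝ) (b : ℝ) (_ : b ≤ t),
    MeasurableSpace.comap (fun ω => dP i ω (Set.Ioc a b)) inferInstance

/-- `lam` is a conditional intensity of the counting process with respect to its internal history
`H`: it is jointly measurable, adapted, locally integrable along almost every path, and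
`E[P_b - P_a | H_a] = E[∫_a^b lam_u du | H_a]`, which is written here through the integrals over the
events of `H_a`. -/
structure IsConditionalIntensity (prob : Measure Ω) (dP : ι → Ω → Measure ℝ)
    (lam : ι → ℝ → Ω → ℝ≥0∞) : Prop where
  measurable : ∀ i, Measurable (fun p : ℝ × Ω => lam i p.1 p.2)
  adapted : ∀ i t, Measurable[history dP t] (lam i t)
  locallyIntegrable : ∀ i a b, ∀ᵐ ω ∂prob, ∫⁻ u in Set.Ioc a b, lam i u ω < ∞
  compensator : ∀ i a b (A : Set Ω), MeasurableSet[history dP a] A →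
    ∫⁻ ω in A, dP i ω (Set.Ioc a b) ∂prob =
      ∫⁻ ω in A, (∫⁻ u in Set.Ioc a b, lam i u ω) ∂prob

/-- Stationary increments: the joint law of the jump measures is invariant under time shifts. -/
def HasStationaryIncrements (prob : Measure Ω) (dP : ι → Ω → Measure ℝ) : Prop :=
  ∀ h : ℝ, IdentDistrib (fun ω i => (dP i ω).map (fun s => s + h)) (fun ω i => dP i ω) prob prob

/-- The process `lam_t = M + Φ ⋆ dP_t`, that is
`lam^i_t = M_i + ∑_j ∫ Φ^{ij}_{t-s} dP^j_s`, for nonnegative `M` and `Φ`. -/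
def hawkesIntensity [Fintype ι] (M : ι → ℝ) (Φ : ℝ → Matrix ι ι ℝ) (dP : ι → Ω → Measure ℝ)
    (i : ι) (t : ℝ) (ω : Ω) : ℝ≥0∞ :=
  ENNReal.ofReal (M i) + ∑ j, ∫⁻ s, ENNReal.ofReal (Φ (t - s) i j) ∂(dP j ω)

/-- A Hawkes process with exogenous intensity `M` and kernel `Φ`. -/
structure IsHawkesProcess [Fintype ι] (prob : Measure Ω) (M : ι → ℝ) (Φ : ℝ → Matrix ι ι ℝ)
    (dP : ι → Ω → Measure ℝ) : Prop where
  counting : IsCountingProcess dP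
  intensity : IsConditionalIntensity prob dP (hawkesIntensity M Φ dP)

end PointProcess

/-! ### The kernels of the model -/

/-- A kernel function: measurable, integrable, nonnegative and causal. -/
structure IsKernelFunction (f : ℝ → ℝ) : Prop where
  measurable : Measurable f
  integrable : Integrable f
  nonneg : ∀ t, 0 ≤ f t
  causal : ∀ t, t < 0 → f t = 0

/-- The eight kernel functions `φ^{?,s}` (self) and `φ^{?,c}` (cross), `? = T, F, I, N`. -/
structure Kernels where
  Ts : ℝ → ℝ
  Tc : ℝ → ℝ
  Fs : ℝ → ℝ
  Fc : ℝ → ℝ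
  Is : ℝ → ℝ
  Ic : ℝ → ℝ
  Ns : ℝ → ℝ
  Nc : ℝ → ℝ

/-- All eight functions are kernel functions. -/
structure Kernels.Admissible (φ : Kernels) : Prop where
  Ts : IsKernelFunction φ.Ts
  Tc : IsKernelFunction φ.Tc
  Fs : IsKernelFunction φ.Fs
  Fc : IsKernelFunction φ.Fc
  Is : IsKernelFunction φ.Is
  Ic : IsKernelFunction φ.Ic
  Ns : IsKernelFunction φ.Ns
  Nc : IsKernelFunction φ.Nc

/-- The four components: `Sum.inl 0, Sum.inl 1` are the trades `T⁻, T⁺`, and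
`Sum.inr 0, Sum.inr 1` are the price jumps `N⁻, N⁺`. -/
abbrev Comp := Fin 2 ⊕ Fin 2

/-- The `2 × 2` symmetric block with self term `s` and cross term `c`. -/
def block (s c : ℝ → ℝ) (t : ℝ) : Matrix (Fin 2) (Fin 2) ℝ := !![s t, c t; c t, s t]

namespace Kernels

variable (φ : Kernels)

def ΦT : ℝ → Matrix (Fin 2) (Fin 2) ℝ := block φ.Ts φ.Tc
def ΦF : ℝ → Matrix (Fin 2) (Fin 2) ℝ := block φ.Fs φ.Fc
def ΦI : ℝ → Matrix (Fin 2) (Fin 2) ℝ := block φ.Is φ.Ic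
def ΦN : ℝ → Matrix (Fin 2) (Fin 2) ℝ := block φ.Ns φ.Nc

/-- The `4 × 4` kernel. -/
def Φ (t : ℝ) : Matrix Comp Comp ℝ :=
  Matrix.fromBlocks (φ.ΦT t) (φ.ΦF t) (φ.ΦI t) (φ.ΦN t)

end Kernels

/-- The exogenous intensity `(μ, μ, 0, 0)`. -/
def exogenous (μ : ℝ) : Comp → ℝ := Sum.elim (fun _ => μ) (fun _ => 0)

/-- The entrywise Laplace transform `∫ e^{-izt} F_t dt` of a matrix of functions. -/
def lap {m n : Type*} (F : ℝ → Matrix m n ℝ) (z : ℂ) : Matrix m n ℂ :=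
  Matrix.of fun i j => ∫ t : ℝ, Complex.exp (-Complex.I * z * t) * (F t i j : ℂ)

namespace Kernels

variable (φ : Kernels)

/-- Condition (H): all complex eigenvalues of the matrix of the integrals of the kernels have
modulus strictly smaller than one. -/
def ConditionH : Prop := ∀ x ∈ spectrum ℂ (lap φ.Φ 0), ‖x‖ < 1

/-- `(I - Φ̂^T_z) (I - Φ̂^N_z) - Φ̂^F_z Φ̂^I_z`. -/
def schur (z : ℂ) : Matrix (Fin 2) (Fin 2) ℂ :=
  (1 - lap φ.ΦT z) * (1 - lap φ.ΦN z) - lap φ.ΦF z * lap φ.ΦI z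

/-- `D̂_z = ((I - Φ̂^T_z) (I - Φ̂^N_z) - Φ̂^F_z Φ̂^I_z)⁻¹ - I`. -/
def Dhat (z : ℂ) : Matrix (Fin 2) (Fin 2) ℂ := (φ.schur z)⁻¹ - 1

end Kernels

end HawkesPrice

end

/-!
By stationarity the mean intensity `Λ` does not depend on time, and the compensator identity
then says that the mean of the jump measure `dP` is `Λ` times Lebesgue measure. Taking
expectations in the definition of the intensity gives `Λ = M + Φ̂(0) Λ`.

For `Im z ≤ 0` causality gives `|Φ̂(z)| ≤ Φ̂(0)` entrywise, hence `|Φ̂(z) ^ k| ≤ Φ̂(0) ^ k` for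
all `k`. By Gelfand's formula some power of `Φ̂(0)` has norm smaller than one, so
`I - Φ̂(z) ^ k` is invertible for some `k`, and so is its factor `I - Φ̂(z)`.

The symmetric `2 × 2` blocks are polynomials in the swap matrix, hence commute. Therefore the
block system is solved by the elimination familiar from scalar `2 × 2` systems, with the
determinant replaced by the matrix `schur`, whose determinant is that of `I - Φ̂(z)`. The
solution is fixed by the swap because the right-hand side is.
-/

namespace HawkesPrice

section BlockMatrices

variable {n R : Type*} [Fintype n] [CommRing R] {A B C D : Matrix n n R}

lemma mulVec_eq_of_fromBlocks_mulVec_eq (hAC : Commute A C) (hAD : Commute A D)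
    (hBC : Commute B C) (hBD : Commute B D) {x y u : n → R}
    (h : Matrix.fromBlocks A (-B) (-C) D *ᵥ Sum.elim x y = Sum.elim u 0) :
    (A * D - B * C) *ᵥ x = D *ᵥ u ∧ (A * D - B * C) *ᵥ y = C *ᵥ u := by
  obtain ⟨htop, hbot⟩ : A *ᵥ x - B *ᵥ y = u ∧ D *ᵥ y = C *ᵥ x := by
    rw [Matrix.fromBlocks_mulVec, Sum.elim_eq_iff] at h
    simpa only [Sum.elim_comp_inl, Sum.elim_comp_inr, Matrix.neg_mulVec, ← sub_eq_add_neg,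
      neg_add_eq_zero, eq_comm (a := C *ᵥ x)] using h
  constructor
  · calc (A * D - B * C) *ᵥ x
        = D *ᵥ (A *ᵥ x) - B *ᵥ (C *ᵥ x) := by
          simp only [Matrix.sub_mulVec, hAD.eq, Matrix.mulVec_mulVec]
      _ = D *ᵥ (A *ᵥ x - B *ᵥ y) := by
          simp only [← hbot, Matrix.mulVec_sub, Matrix.mulVec_mulVec, hBD.eq]
      _ = D *ᵥ u := by rw [htop]
  · calc (A * D - B * C) *ᵥ y
        = A *ᵥ (D *ᵥ y) - C *ᵥ (B *ᵥ y) := by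
          simp only [Matrix.sub_mulVec, hBC.eq, Matrix.mulVec_mulVec]
      _ = C *ᵥ (A *ᵥ x - B *ᵥ y) := by
          simp only [hbot, Matrix.mulVec_sub, Matrix.mulVec_mulVec, hAC.eq]
      _ = C *ᵥ u := by rw [htop]

variable [DecidableEq n]

lemma det_fromBlocks_mul_det_of_commute (A B : Matrix n n R) (hCD : Commute C D) :
    (Matrix.fromBlocks A B C D).det * D.det = (A * D - B * C).det * D.det := by
  have htri : Matrix.fromBlocks A B C D * Matrix.fromBlocks D 0 (-C) 1 =
      Matrix.fromBlocks (A * D - B * C) B 0 D := by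
    simp [Matrix.fromBlocks_multiply, hCD.eq, sub_eq_add_neg]
  simpa using congrArg Matrix.det htri

open Polynomial in
lemma det_fromBlocks_of_commute (A B : Matrix n n R) (hCD : Commute C D) :
    (Matrix.fromBlocks A B C D).det = (A * D - B * C).det := by
  -- Replace `D` by the generic matrix `X + D`, whose monic determinant can be cancelled.
  have hcomm : Commute (C.map Polynomial.C) (Matrix.charmatrix (-D)) := by
    have hCD' : Commute (C.map Polynomial.C) ((-D).map Polynomial.C) :=
      hCD.neg_right.map (Polynomial.C : R →+* R[X]).mapMatrix
    exact (Matrix.scalar_commute _ (Commute.all _) _).symm.sub_right hCD'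
  have hgeneric := (Matrix.charpoly_monic (-D)).isRegular.right
    (det_fromBlocks_mul_det_of_commute (A.map Polynomial.C) (B.map Polynomial.C) hcomm)
  have heval : ∀ M : Matrix n n R, (M.map Polynomial.C).map (evalRingHom 0) = M := fun M => by
    ext; simp
  have hevalD : (Matrix.charmatrix (-D)).map (evalRingHom 0) = D := by
    ext i j; by_cases h : i = j <;> simp [Matrix.charmatrix, h]
  simpa only [RingHom.map_det, RingHom.mapMatrix_apply, Matrix.fromBlocks_map, map_sub, map_mul,
    heval, hevalD] using congrArg (evalRingHom 0) hgeneric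

lemma eq_inv_mulVec_of_mulVec_eq {S : Matrix n n R} (hS : IsUnit S) {x y : n → R}
    (h : S *ᵥ x = y) : x = S⁻¹ *ᵥ y := by
  obtain ⟨_⟩ := hS.nonempty_invertible
  exact (Matrix.inv_mulVec_eq_vec h.symm).symm

lemma mulVec_eq_self_of_commute {J S D : Matrix n n R} (hS : IsUnit S) (hJS : Commute J S)
    (hJD : Commute J D) {x u : n → R} (hu : J *ᵥ u = u) (h : S *ᵥ x = D *ᵥ u) : J *ᵥ x = x := by
  refine Matrix.mulVec_injective_of_isUnit hS ?_
  calc S *ᵥ (J *ᵥ x) = J *ᵥ (S *ᵥ x) := by simp only [Matrix.mulVec_mulVec, hJS.eq]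
    _ = D *ᵥ (J *ᵥ u) := by simp only [h, Matrix.mulVec_mulVec, hJD.eq]
    _ = S *ᵥ x := by rw [hu, h]

end BlockMatrices

section SpectralRadius

lemma exists_norm_pow_lt_one {A : Type*} [NormedRing A] [NormedAlgebra ℂ A] [CompleteSpace A]
    {a : A} (ha : ∀ z ∈ spectrum ℂ a, ‖z‖ < 1) : ∃ k : ℕ, ‖a ^ k‖ < 1 := by
  cases subsingleton_or_nontrivial A
  · exact ⟨0, by rw [Subsingleton.elim (a ^ 0) 0, norm_zero]; exact one_pos⟩
  have hr : spectralRadius ℂ a < (1 : ℝ≥0) :=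
    spectrum.spectralRadius_lt_of_forall_lt a fun z hz => mod_cast ha z hz
  obtain ⟨k, hk, hk0⟩ := (((spectrum.gelfand_formula a).eventually_lt_const hr).and
    (Filter.eventually_gt_atTop 0)).exists
  refine ⟨k, lt_of_not_ge fun hge => hk.not_ge ?_⟩
  exact ENNReal.one_le_rpow (mod_cast hge) (by positivity)

variable {n : Type*} [Fintype n] [DecidableEq n]

lemma norm_pow_apply_le {R : Type*} [NormedRing R] [NormOneClass R] {A : Matrix n n R}
    {b : Matrix n n ℝ} (hAb : ∀ i j, ‖A i j‖ ≤ b i j) (k : ℕ) (i j : n) :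
    ‖(A ^ k) i j‖ ≤ (b ^ k) i j := by
  induction k generalizing i j with
  | zero => by_cases h : i = j <;> simp [h]
  | succ k ih =>
    simp only [pow_succ, Matrix.mul_apply]
    refine norm_sum_le_of_le _ fun l _ => (norm_mul_le _ _).trans ?_
    exact mul_le_mul (ih i l) (hAb l j) (norm_nonneg _) ((norm_nonneg _).trans (ih i l))

open scoped Matrix.Norms.Operator in
lemma linftyOpNorm_le_of_norm_apply_le {m n R S : Type*} [Fintype m] [Fintype n]
    [SeminormedAddCommGroup R] [SeminormedAddCommGroup S] {A : Matrix m n R} {B : Matrix m n S}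
    (h : ∀ i j, ‖A i j‖ ≤ ‖B i j‖) : ‖A‖ ≤ ‖B‖ := by
  simp only [Matrix.linfty_opNorm_def]
  exact NNReal.coe_le_coe.2 <| Finset.sup_mono_fun fun i _ => Finset.sum_le_sum fun j _ => h i j

open scoped Matrix.Norms.Operator in
lemma isUnit_one_sub_of_norm_apply_le {A : Matrix n n ℂ} {b : Matrix n n ℝ}
    (hAb : ∀ i j, ‖A i j‖ ≤ b i j)
    (hb : ∀ z ∈ spectrum ℂ (b.map Complex.ofRealHom), ‖z‖ < 1) : IsUnit (1 - A) := by
  obtain ⟨k, hk⟩ := exists_norm_pow_lt_one hb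
  have hle : ‖A ^ k‖ ≤ ‖b.map Complex.ofRealHom ^ k‖ := by
    refine linftyOpNorm_le_of_norm_apply_le fun i j => (norm_pow_apply_le hAb k i j).trans ?_
    rw [← Matrix.map_pow]
    simpa using le_abs_self _
  have hunit : IsUnit (1 - A ^ k) := isUnit_one_sub_of_norm_lt_one (hle.trans_lt hk)
  rw [← mul_neg_geom_sum] at hunit
  rw [Matrix.isUnit_iff_isUnit_det, Matrix.det_mul] at hunit
  rw [Matrix.isUnit_iff_isUnit_det]
  exact isUnit_of_mul_isUnit_left hunit

end SpectralRadius

section MeanIntensity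

variable {Ω ι : Type*}

lemma measurable_ofReal_comp_sub_left {f : ℝ → ℝ} (hf : Measurable f) (t : ℝ) :
    Measurable fun s => ENNReal.ofReal (f (t - s)) := by
  fun_prop

lemma measurable_lintegral_ofReal_comp_sub_left [MeasurableSpace Ω] {f : ℝ → ℝ}
    (hf : Measurable f) {N : Ω → Measure ℝ} (hN : Measurable N) (t : ℝ) :
    Measurable fun ω => ∫⁻ s, ENNReal.ofReal (f (t - s)) ∂(N ω) :=
  (Measure.measurable_lintegral (measurable_ofReal_comp_sub_left hf t)).comp hN

lemma IsConditionalIntensity.bind_eq_smul_volume [MeasurableSpace Ω] {prob : Measure Ω}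
    [SFinite prob] {dP : ι → Ω → Measure ℝ} {lam : ι → ℝ → Ω → ℝ≥0∞}
    (hlam : IsConditionalIntensity prob dP lam) {i : ι} (hdP : Measurable (dP i)) {Λ : ℝ≥0}
    (hmean : ∀ t, ∫⁻ ω, lam i t ω ∂prob = Λ) :
    prob.bind (dP i) = (Λ : ℝ≥0∞) • volume := by
  have hIoc (a b : ℝ) : prob.bind (dP i) (Set.Ioc a b) = Λ * volume (Set.Ioc a b) := by
    calc prob.bind (dP i) (Set.Ioc a b)
        = ∫⁻ ω, dP i ω (Set.Ioc a b) ∂prob :=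
          Measure.bind_apply measurableSet_Ioc hdP.aemeasurable
      _ = ∫⁻ ω, (∫⁻ u in Set.Ioc a b, lam i u ω) ∂prob := by
          simpa only [Measure.restrict_univ] using
            hlam.compensator i a b Set.univ MeasurableSet.univ
      _ = ∫⁻ u in Set.Ioc a b, ∫⁻ ω, lam i u ω ∂prob :=
          lintegral_lintegral_swap ((hlam.measurable i).comp measurable_swap).aemeasurable
      _ = Λ * volume (Set.Ioc a b) := by simp only [hmean, setLIntegral_const]
  refine Measure.ext_of_Ioc' _ _ (fun a b _ => ?_) fun a b _ => ?_
  · rw [hIoc, Real.volume_Ioc]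
    exact ENNReal.mul_ne_top ENNReal.coe_ne_top ENNReal.ofReal_ne_top
  · rw [hIoc, Measure.smul_apply, smul_eq_mul]

variable [Fintype ι] {M : ι → ℝ} {Φ : ℝ → Matrix ι ι ℝ} {dP : ι → Ω → Measure ℝ}

lemma measurable_hawkesIntensity [MeasurableSpace Ω] (hΦ : ∀ i j, Measurable fun t => Φ t i j)
    (hdP : ∀ i, Measurable (dP i)) (i : ι) (t : ℝ) : Measurable (hawkesIntensity M Φ dP i t) :=
  (Finset.measurable_fun_sum _ fun j _ =>
    measurable_lintegral_ofReal_comp_sub_left (hΦ i j) (hdP j) t).const_add _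

-- With the coordinate maps `Function.eval` as jump measures, the intensity at time `0` becomes a
-- fixed functional on the space of tuples of measures, to which stationarity applies.
lemma hawkesIntensity_eq_hawkesIntensity_zero_map_add (hΦ : ∀ i j, Measurable fun t => Φ t i j)
    (i : ι) (t : ℝ) (ω : Ω) :
    hawkesIntensity M Φ dP i t ω =
      hawkesIntensity M Φ Function.eval i 0 fun j => (dP j ω).map (· + -t) := by
  unfold hawkesIntensity
  congr 1
  refine Finset.sum_congr rfl fun j _ => ?_
  rw [Function.eval, lintegral_map (measurable_ofReal_comp_sub_left (hΦ i j) 0) (by fun_prop)]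
  simp [sub_eq_add_neg, add_comm]

variable [MeasurableSpace Ω] {prob : Measure Ω}

lemma HasStationaryIncrements.lintegral_hawkesIntensity_eq (hstat : HasStationaryIncrements prob dP)
    (hΦ : ∀ i j, Measurable fun t => Φ t i j) (i : ι) (t : ℝ) :
    ∫⁻ ω, hawkesIntensity M Φ dP i t ω ∂prob = ∫⁻ ω, hawkesIntensity M Φ dP i 0 ω ∂prob := by
  have hmeas : Measurable (hawkesIntensity M Φ Function.eval i 0) :=
    measurable_hawkesIntensity hΦ measurable_pi_apply i 0
  calc ∫⁻ ω, hawkesIntensity M Φ dP i t ω ∂prob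
      = ∫⁻ ω, hawkesIntensity M Φ Function.eval i 0 (fun j => (dP j ω).map (· + -t)) ∂prob :=
        lintegral_congr fun ω => hawkesIntensity_eq_hawkesIntensity_zero_map_add hΦ i t ω
    _ = ∫⁻ ω, hawkesIntensity M Φ dP i 0 ω ∂prob := ((hstat (-t)).comp hmeas).lintegral_eq

lemma IsConditionalIntensity.mean_hawkesIntensity_eq [IsProbabilityMeasure prob]
    (hlam : IsConditionalIntensity prob dP (hawkesIntensity M Φ dP))
    (hdP : ∀ i, Measurable (dP i)) (hΦ : ∀ i j, Measurable fun t => Φ t i j) {Λ : ι → ℝ≥0}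
    (hmean : ∀ i t, ∫⁻ ω, hawkesIntensity M Φ dP i t ω ∂prob = Λ i) (i : ι) :
    (Λ i : ℝ≥0∞) = ENNReal.ofReal (M i) + ∑ j, Λ j * ∫⁻ s, ENNReal.ofReal (Φ s i j) := by
  have hterm (j : ι) : ∫⁻ ω, ∫⁻ s, ENNReal.ofReal (Φ (0 - s) i j) ∂(dP j ω) ∂prob =
      Λ j * ∫⁻ s, ENNReal.ofReal (Φ s i j) := by
    rw [← Measure.lintegral_bind (hdP j).aemeasurable
        (measurable_ofReal_comp_sub_left (hΦ i j) 0).aemeasurable,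
      hlam.bind_eq_smul_volume (hdP j) (hmean j), lintegral_smul_measure, smul_eq_mul,
      lintegral_sub_left_eq_self (fun s => ENNReal.ofReal (Φ s i j)) 0]
  simp only [← hmean i 0, hawkesIntensity]
  rw [lintegral_add_left measurable_const, lintegral_const, measure_univ, mul_one,
    lintegral_finsetSum _ fun j _ => measurable_lintegral_ofReal_comp_sub_left (hΦ i j) (hdP j) 0]
  simp only [hterm]

end MeanIntensity

section Laplace

variable {m n : Type*}

lemma lap_zero_apply (F : ℝ → Matrix m n ℝ) (i : m) (j : n) :
    lap F 0 i j = ((∫ t, F t i j : ℝ) : ℂ) := by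
  simpa [lap] using integral_ofReal (𝕜 := ℂ) (f := fun t => F t i j)

lemma norm_lap_apply_le {F : ℝ → Matrix m n ℝ} {i : m} {j : n}
    (hF : IsKernelFunction fun t => F t i j) {z : ℂ} (hz : z.im ≤ 0) :
    ‖lap F z i j‖ ≤ ∫ t, F t i j := by
  refine norm_integral_le_of_norm_le hF.integrable (ae_of_all _ fun t => ?_)
  rw [norm_mul, Complex.norm_exp, Complex.norm_real, Real.norm_of_nonneg (hF.nonneg t)]
  rcases lt_or_ge t 0 with ht | ht
  · simp [hF.causal t ht]
  · refine mul_le_of_le_one_left (hF.nonneg t) (Real.exp_le_one_iff.2 ?_)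
    simpa using mul_nonpos_of_nonpos_of_nonneg hz ht

variable [Fintype n] [DecidableEq n] {F : ℝ → Matrix n n ℝ}

lemma isUnit_one_sub_lap (hF : ∀ i j, IsKernelFunction fun t => F t i j)
    (hspec : ∀ x ∈ spectrum ℂ (lap F 0), ‖x‖ < 1) {z : ℂ} (hz : z.im ≤ 0) :
    IsUnit (1 - lap F z) := by
  have hzero : (Matrix.of fun i j => ∫ t, F t i j).map Complex.ofRealHom = lap F 0 := by
    ext i j
    exact (lap_zero_apply F i j).symm
  rw [← hzero] at hspec
  exact isUnit_one_sub_of_norm_apply_le (fun i j => norm_lap_apply_le (hF i j) hz) hspec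

lemma one_sub_lap_zero_mulVec_eq (hF : ∀ i j, IsKernelFunction fun t => F t i j) {M : n → ℝ}
    (hM : ∀ i, 0 ≤ M i) {Λ : n → ℝ≥0}
    (h : ∀ i, (Λ i : ℝ≥0∞) =
      ENNReal.ofReal (M i) + ∑ j, Λ j * ∫⁻ s, ENNReal.ofReal (F s i j)) :
    (1 - lap F 0) *ᵥ (fun i => ((Λ i : ℝ) : ℂ)) = fun i => (M i : ℂ) := by
  have hreal (i : n) : (Λ i : ℝ) = M i + ∑ j, Λ j * ∫ s, F s i j := by
    have hnonneg (j : n) : 0 ≤ Λ j * ∫ s, F s i j :=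
      mul_nonneg (Λ j).coe_nonneg (integral_nonneg (hF i j).nonneg)
    have hprod (j : n) : (Λ j : ℝ≥0∞) * ∫⁻ s, ENNReal.ofReal (F s i j) =
        ENNReal.ofReal (Λ j * ∫ s, F s i j) := by
      rw [ENNReal.ofReal_mul (Λ j).coe_nonneg, ENNReal.ofReal_coe_nnreal,
        ofReal_integral_eq_lintegral_ofReal (hF i j).integrable (ae_of_all _ (hF i j).nonneg)]
    have hi := h i
    simp only [hprod] at hi
    rw [← ENNReal.ofReal_sum_of_nonneg fun j _ => hnonneg j,
      ← ENNReal.ofReal_add (hM i) (Finset.sum_nonneg fun j _ => hnonneg j)] at hi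
    rw [← ENNReal.coe_toReal (Λ i), hi, ENNReal.toReal_ofReal
      (add_nonneg (hM i) (Finset.sum_nonneg fun j _ => hnonneg j))]
  ext i
  rw [Matrix.sub_mulVec, Matrix.one_mulVec, Pi.sub_apply, hreal i]
  simp only [Matrix.mulVec, dotProduct, lap_zero_apply, Complex.ofReal_add, Complex.ofReal_sum,
    Complex.ofReal_mul, mul_comm, add_sub_cancel_right]

theorem exists_mean_hawkesIntensity {Ω : Type*} [MeasurableSpace Ω] {prob : Measure Ω}
    [IsProbabilityMeasure prob] {M : n → ℝ} (hM : ∀ i, 0 ≤ M i)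
    (hF : ∀ i j, IsKernelFunction fun t => F t i j) {dP : n → Ω → Measure ℝ}
    (hdP : ∀ i, Measurable (dP i))
    (hlam : IsConditionalIntensity prob dP (hawkesIntensity M F dP))
    (hstat : HasStationaryIncrements prob dP)
    (hfin : ∀ i, ∫⁻ ω, hawkesIntensity M F dP i 0 ω ∂prob ≠ ∞) :
    ∃ Λ : n → ℝ≥0, (∀ i t, ∫⁻ ω, hawkesIntensity M F dP i t ω ∂prob = Λ i) ∧
      (1 - lap F 0) *ᵥ (fun i => ((Λ i : ℝ) : ℂ)) = fun i => (M i : ℂ) := by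
  have hmeas (i j : n) : Measurable fun t => F t i j := (hF i j).measurable
  have hmean (i : n) (t : ℝ) : ∫⁻ ω, hawkesIntensity M F dP i t ω ∂prob =
      (∫⁻ ω, hawkesIntensity M F dP i 0 ω ∂prob).toNNReal := by
    rw [hstat.lintegral_hawkesIntensity_eq hmeas, ENNReal.coe_toNNReal (hfin i)]
  exact ⟨_, hmean,
    one_sub_lap_zero_mulVec_eq hF hM (hlam.mean_hawkesIntensity_eq hdP hmeas hmean)⟩

end Laplace

section SymmetricBlocks

lemma exogenous_nonneg {μ : ℝ} (hμ : 0 ≤ μ) : ∀ i, 0 ≤ exogenous μ i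
  | Sum.inl _ => hμ
  | Sum.inr _ => le_rfl

lemma lap_block_mem_adjoin_swap (s c : ℝ → ℝ) (z : ℂ) :
    lap (block s c) z ∈ Algebra.adjoin ℂ {Matrix.swap ℂ (0 : Fin 2) 1} := by
  have hsum : lap (block s c) z = algebraMap ℂ _ (lap (block s c) z 0 0) +
      lap (block s c) z 0 1 • Matrix.swap ℂ (0 : Fin 2) 1 := by
    ext i j
    fin_cases i <;> fin_cases j <;>
      simp [lap, block, Matrix.algebraMap_matrix_apply, Matrix.swap, PEquiv.toMatrix_apply]
  rw [hsum]
  exact add_mem (Subalgebra.algebraMap_mem _ _)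
    (Subalgebra.smul_mem _ (Algebra.self_mem_adjoin_singleton ℂ _) _)

lemma commute_lap_block (s c s' c' : ℝ → ℝ) (z : ℂ) :
    Commute (lap (block s c) z) (lap (block s' c') z) :=
  setLike_mul_comm (lap_block_mem_adjoin_swap s c z) (lap_block_mem_adjoin_swap s' c' z)

lemma eq_const_of_mulVec_const_eq {S D : Matrix (Fin 2) (Fin 2) ℂ} (hS : IsUnit S)
    (hSmem : S ∈ Algebra.adjoin ℂ {Matrix.swap ℂ (0 : Fin 2) 1})
    (hDmem : D ∈ Algebra.adjoin ℂ {Matrix.swap ℂ (0 : Fin 2) 1}) {x : Fin 2 → ℂ} {c : ℂ}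
    (h : S *ᵥ x = D *ᵥ fun _ => c) : x = fun _ => x 0 := by
  have hconst : Matrix.swap ℂ (0 : Fin 2) 1 *ᵥ (fun _ => c) = fun _ => c := by
    ext i
    rw [Matrix.swap_mulVec]
    rfl
  have hx : Matrix.swap ℂ (0 : Fin 2) 1 *ᵥ x = x :=
    mulVec_eq_self_of_commute hS (Algebra.commute_of_mem_adjoin_self hSmem)
      (Algebra.commute_of_mem_adjoin_self hDmem) hconst h
  have h10 : x 1 = x 0 := by
    simpa [Matrix.swap_mulVec] using congrFun hx 0
  ext i
  fin_cases i
  exacts [rfl, h10]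

namespace Kernels

variable {φ : Kernels}

lemma Admissible.isKernelFunction (hφ : φ.Admissible) (i j : Comp) :
    IsKernelFunction fun t => φ.Φ t i j := by
  obtain ⟨hTs, hTc, hFs, hFc, hIs, hIc, hNs, hNc⟩ := hφ
  rcases i with i | i <;> rcases j with j | j <;> fin_cases i <;> fin_cases j <;> assumption

lemma one_sub_lap_Φ (φ : Kernels) (z : ℂ) : 1 - lap φ.Φ z =
    Matrix.fromBlocks (1 - lap φ.ΦT z) (-lap φ.ΦF z) (-lap φ.ΦI z) (1 - lap φ.ΦN z) := by
  have hblocks : lap φ.Φ z =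
      Matrix.fromBlocks (lap φ.ΦT z) (lap φ.ΦF z) (lap φ.ΦI z) (lap φ.ΦN z) := by
    ext (i | i) (j | j) <;> rfl
  rw [hblocks, ← Matrix.fromBlocks_one, sub_eq_add_neg, Matrix.fromBlocks_neg,
    Matrix.fromBlocks_add]
  simp only [zero_sub, ← sub_eq_add_neg]

lemma isUnit_schur {z : ℂ} (h : IsUnit (1 - lap φ.Φ z)) : IsUnit (φ.schur z) := by
  have hcomm : Commute (-lap φ.ΦI z) (1 - lap φ.ΦN z) :=
    ((Commute.one_right _).sub_right (commute_lap_block _ _ _ _ z)).neg_left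
  rw [one_sub_lap_Φ, Matrix.isUnit_iff_isUnit_det, det_fromBlocks_of_commute _ _ hcomm,
    neg_mul_neg] at h
  exact (Matrix.isUnit_iff_isUnit_det _).2 h

lemma schur_mulVec_eq {z : ℂ} {μ : ℝ} {x : Comp → ℂ}
    (hx : (1 - lap φ.Φ z) *ᵥ x = fun i => (exogenous μ i : ℂ)) :
    φ.schur z *ᵥ (x ∘ Sum.inl) = (1 - lap φ.ΦN z) *ᵥ (fun _ => (μ : ℂ)) ∧
      φ.schur z *ᵥ (x ∘ Sum.inr) = lap φ.ΦI z *ᵥ (fun _ => (μ : ℂ)) := by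
  have hexo : (fun i => (exogenous μ i : ℂ)) = Sum.elim (fun _ => (μ : ℂ)) 0 := by
    ext (_ | _) <;> simp [exogenous]
  have hTI : Commute (1 - lap φ.ΦT z) (lap φ.ΦI z) :=
    (Commute.one_left _).sub_left (commute_lap_block _ _ _ _ z)
  have hTN : Commute (1 - lap φ.ΦT z) (1 - lap φ.ΦN z) :=
    (Commute.one_right _).sub_right ((Commute.one_left _).sub_left (commute_lap_block _ _ _ _ z))
  have hFN : Commute (lap φ.ΦF z) (1 - lap φ.ΦN z) :=
    (Commute.one_right _).sub_right (commute_lap_block _ _ _ _ z)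
  have hFI : Commute (lap φ.ΦF z) (lap φ.ΦI z) := commute_lap_block _ _ _ _ z
  refine mulVec_eq_of_fromBlocks_mulVec_eq hTI hTN hFI hFN ?_
  rw [← one_sub_lap_Φ, Sum.elim_comp_inl_inr, hx, hexo]

lemma schur_mem_adjoin_swap (φ : Kernels) (z : ℂ) :
    φ.schur z ∈ Algebra.adjoin ℂ {Matrix.swap ℂ (0 : Fin 2) 1} :=
  sub_mem
    (mul_mem (sub_mem (one_mem _) (lap_block_mem_adjoin_swap _ _ z))
      (sub_mem (one_mem _) (lap_block_mem_adjoin_swap _ _ z)))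
    (mul_mem (lap_block_mem_adjoin_swap _ _ z) (lap_block_mem_adjoin_swap _ _ z))

lemma apply_eq_of_one_sub_lap_mulVec_eq {z : ℂ} (hz : IsUnit (1 - lap φ.Φ z)) {μ : ℝ}
    {x : Comp → ℂ} (hx : (1 - lap φ.Φ z) *ᵥ x = fun i => (exogenous μ i : ℂ)) :
    (∀ i, x (Sum.inl i) = x (Sum.inl 0)) ∧ ∀ i, x (Sum.inr i) = x (Sum.inr 0) := by
  obtain ⟨hT, hN⟩ := schur_mulVec_eq hx
  have hS := φ.schur_mem_adjoin_swap z
  exact ⟨congrFun (eq_const_of_mulVec_const_eq (isUnit_schur hz) hS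
      (sub_mem (one_mem _) (lap_block_mem_adjoin_swap _ _ z)) hT),
    congrFun (eq_const_of_mulVec_const_eq (isUnit_schur hz) hS
      (lap_block_mem_adjoin_swap _ _ z) hN)⟩

lemma eq_smul_one_add_Dhat_mul_mulVec {z : ℂ} (hz : IsUnit (φ.schur z))
    {D : Matrix (Fin 2) (Fin 2) ℂ} {x : Fin 2 → ℂ} {c : ℂ}
    (h : φ.schur z *ᵥ x = D *ᵥ fun _ => c) :
    x = c • (((1 + φ.Dhat z) * D) *ᵥ ![1, 1]) := by
  have hDhat : 1 + φ.Dhat z = (φ.schur z)⁻¹ := add_sub_cancel _ _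
  have hc : (fun _ => c) = c • ![1, 1] := by
    ext i
    fin_cases i <;> simp
  rw [eq_inv_mulVec_of_mulVec_eq hz h, hc, hDhat, Matrix.mulVec_smul, Matrix.mulVec_smul,
    Matrix.mulVec_mulVec]

end Kernels

end SymmetricBlocks

end HawkesPrice

open HawkesPrice in
theorem proposition2_general {Ω : Type*} [MeasurableSpace Ω] (prob : Measure Ω)
    [IsProbabilityMeasure prob] (φ : Kernels) (hφ : φ.Admissible) (hH : φ.ConditionH) (μ : ℝ)
    (hμ : 0 ≤ μ) (dP : Comp → Ω → Measure ℝ) (hdP : ∀ i, Measurable (dP i))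
    (hlam : IsConditionalIntensity prob dP (hawkesIntensity (exogenous μ) φ.Φ dP))
    (hstat : HasStationaryIncrements prob dP)
    (hfin : ∀ i, ∫⁻ ω, hawkesIntensity (exogenous μ) φ.Φ dP i 0 ω ∂prob ≠ ∞) :
    IsUnit (1 - lap φ.Φ 0) ∧
    (∀ z : ℂ, z.im ≤ 0 → IsUnit (φ.schur z)) ∧
    ∃ ΛT ΛN : ℝ≥0,
      (∀ t i, ∫⁻ ω, hawkesIntensity (exogenous μ) φ.Φ dP (Sum.inl i) t ω ∂prob = ΛT) ∧
      (∀ t i, ∫⁻ ω, hawkesIntensity (exogenous μ) φ.Φ dP (Sum.inr i) t ω ∂prob = ΛN) ∧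
      Sum.elim (fun _ : Fin 2 => ((ΛT : ℝ) : ℂ)) (fun _ : Fin 2 => ((ΛN : ℝ) : ℂ)) =
        (1 - lap φ.Φ 0)⁻¹ *ᵥ (fun i => (exogenous μ i : ℂ)) ∧
      ![((ΛT : ℝ) : ℂ), ((ΛT : ℝ) : ℂ)] =
        (μ : ℂ) • (((1 + φ.Dhat 0) * (1 - lap φ.ΦN 0)) *ᵥ ![1, 1]) ∧
      ![((ΛN : ℝ) : ℂ), ((ΛN : ℝ) : ℂ)] =
        (μ : ℂ) • (((1 + φ.Dhat 0) * lap φ.ΦI 0) *ᵥ ![1, 1]) := by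
  have hunit (z : ℂ) (hz : z.im ≤ 0) : IsUnit (1 - lap φ.Φ z) :=
    isUnit_one_sub_lap hφ.isKernelFunction hH hz
  have hunit0 := hunit 0 le_rfl
  obtain ⟨Λ, hmean, hΛ⟩ := exists_mean_hawkesIntensity (exogenous_nonneg hμ) hφ.isKernelFunction
    hdP hlam hstat hfin
  obtain ⟨ΛT, ΛN, rfl⟩ : ∃ ΛT ΛN : ℝ≥0, Λ = Sum.elim (fun _ => ΛT) (fun _ => ΛN) := by
    obtain ⟨hT, hN⟩ := Kernels.apply_eq_of_one_sub_lap_mulVec_eq hunit0 hΛ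
    refine ⟨Λ (Sum.inl 0), Λ (Sum.inr 0), ?_⟩
    ext (i | i)
    exacts [mod_cast hT i, mod_cast hN i]
  obtain ⟨hT, hN⟩ := Kernels.schur_mulVec_eq hΛ
  refine ⟨hunit0, fun z hz => Kernels.isUnit_schur (hunit z hz), ΛT, ΛN,
    fun t i => hmean (Sum.inl i) t, fun t i => hmean (Sum.inr i) t, ?_, ?_, ?_⟩
  · rw [← eq_inv_mulVec_of_mulVec_eq hunit0 hΛ]
    ext (i | i) <;> rfl
  · rw [← Kernels.eq_smul_one_add_Dhat_mul_mulVec (Kernels.isUnit_schur hunit0) hT]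
    ext i; fin_cases i <;> rfl
  · rw [← Kernels.eq_smul_one_add_Dhat_mul_mulVec (Kernels.isUnit_schur hunit0) hN]
    ext i; fin_cases i <;> rfl

open HawkesPrice in
theorem proposition2 {Ω : Type*} [MeasurableSpace Ω] (prob : Measure Ω) [IsProbabilityMeasure prob]
    (φ : Kernels) (hφ : φ.Admissible) (hH : φ.ConditionH) (μ : ℝ) (hμ : 0 ≤ μ)
    (dP : Comp → Ω → Measure ℝ)
    (hP : IsHawkesProcess prob (exogenous μ) φ.Φ dP)
    (hstat : HasStationaryIncrements prob dP)
    (hfin : ∀ i, ∫⁻ ω, hawkesIntensity (exogenous μ) φ.Φ dP i 0 ω ∂prob ≠ ∞) :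
    -- the inverse matrices in the formulas exist
    IsUnit (1 - lap φ.Φ 0) ∧
    (∀ z : ℂ, z.im ≤ 0 → IsUnit (φ.schur z)) ∧
    ∃ ΛT ΛN : ℝ≥0,
      -- the mean intensity, at any time, is the vector `(ΛT, ΛT, ΛN, ΛN)`
      (∀ t i, ∫⁻ ω, hawkesIntensity (exogenous μ) φ.Φ dP (Sum.inl i) t ω ∂prob = ΛT) ∧
      (∀ t i, ∫⁻ ω, hawkesIntensity (exogenous μ) φ.Φ dP (Sum.inr i) t ω ∂prob = ΛN) ∧
      -- and it is given by the formulas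
      Sum.elim (fun _ : Fin 2 => ((ΛT : ℝ) : ℂ)) (fun _ : Fin 2 => ((ΛN : ℝ) : ℂ)) =
        (1 - lap φ.Φ 0)⁻¹ *ᵥ (fun i => (exogenous μ i : ℂ)) ∧
      ![((ΛT : ℝ) : ℂ), ((ΛT : ℝ) : ℂ)] =
        (μ : ℂ) • (((1 + φ.Dhat 0) * (1 - lap φ.ΦN 0)) *ᵥ ![1, 1]) ∧
      ![((ΛN : ℝ) : ℂ), ((ΛN : ℝ) : ℂ)] =
        (μ : ℂ) • (((1 + φ.Dhat 0) * lap φ.ΦI 0) *ᵥ ![1, 1]) :=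
  proposition2_general prob φ hφ hH μ hμ dP hP.counting.measurable hP.intensity hstat hfin
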